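/- Fix a countably infinite set $Var$ of propositional variables and a countably infinite set $Ind$ of individual variables. Let $\mathcal L$ be the set of formulas built from $Var$ by $\bot,\top,\wedge,\vee,\to$ and two binary conditionals $\Box\!\!\to$ and $\Diamond\!\!\to$. **Models.** A Chellas model is $\mathcal M=(W,\le,R,V)$ with $W\ne\emptyset$, $\le$ a pre-order on $W$, $V(p)\subseteq W$ upward closed for all $p\in Var$, and $R\subseteq W\times\mathcal P(W)\times W$ such that, writing $R_X(w,v)$ for $(w,X,v)\in R$, for every $X\subseteq W$: (c1) if $w\le w'$ and $R_X(w,v)$, then $R_X(w',v')$ for some $v'\ge v$; (c2) if $R_X(w,v)$ and $v\le v'$, then $R_X(w',v')$ for some $w'\ge w$. Satisfaction $\mathcal M,w\models\phi$ is that of intuitionistic Kripke semantics for variables and $\bot,\top,\wedge,\vee,\to$; with $\|\psi\|=\{v\mid\mathcal M,v\models\psi\}$, $\mathcal M,w\models\psi\,\Box\!\!\to\chi$ iff for all $v\ge w$ and all $u$, $R_{\|\psi\|}(v,u)$ implies $\mathcal M,u\models\chi$; and $\mathcal M,w\models\psi\,\Diamond\!\!\to\chi$ iff $R_{\|\psi\|}(w,u)$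 and $\mathcal M,u\models\chi$ for some $u$. For $\Gamma,\Delta\subseteq\mathcal L$, write $\Gamma\models_{\mathsf{IntCK}}\Delta$ iff there are no $\mathcal M$ and $w\in W$ such that $\mathcal M,w$ satisfies every formula in $\Gamma$ and no formula in $\Delta$. **First-order side.** First-order formulas are built from the atoms $px$ ($p\in Var$), $Rxyz$, $Ox$, $Sx$, $Exy$, $x\equiv y$, $\top$, $\bot$ by $\wedge,\vee,\to,\forall,\exists$; $(\forall x)_O\phi$ abbreviates $\forall x(Ox\to\phi)$. A Kripke sheaf consists of a non-empty pre-ordered set $(W,\le)$, a classical structure $\mathfrak A_w$ with non-empty domain $A_w$ for this vocabulary at every $w\in W$, and homomorphisms $\mathbb H_{wv}:\mathfrak A_w\to\mathfrak A_v$ for $w\le v$ such that $\mathbb H_{ww}$ is the identity and $\mathbb H_{wu}(a)=\mathbb H_{vu}(\mathbb H_{wv}(a))$ for $w\le v\le u$. Satisfaction at $w$ under $f:Ind\to A_w$ is defined with atoms (including $\equiv$, as identity), $\wedge$, $\vee$, $\exists$ read classically in $\mathfrak A_w$, and with $\to$ and $\forall$ read over all $v\ge w$, transporting $f$ along $\mathbb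 H_{wv}$. For sets $\Phi,\Psi$ of first-order formulas, write $\Phi\models_{fo}\Psi$ iff no node of a Kripke sheaf with an assignment into its domain satisfies every formula in $\Phi$ and no formula in $\Psi$. **The theory.** $Th$ consists of the following sentences, for all $p\in Var$ and $*\in\{\wedge,\vee,\to\}$: 1. $\forall x(Sx\vee Ox)$ 2. $\forall x\neg(Sx\wedge Ox)$ 3. $\forall x(px\to Ox)$ 4. $\forall x\forall y(Exy\to(Ox\wedge Sy))$ 5. $\forall x\forall y\forall z(Rxyz\to(Ox\wedge Sy\wedge Oz))$ 6. $\exists x(Sx\wedge\forall y(Eyx\leftrightarrow py))$ 7. $\exists x(Sx\wedge(\forall y)_OEyx)$ 8. $\exists x(Sx\wedge\forall y\neg Eyx)$ 9. $\forall x\forall y((Sx\wedge Sy)\to\exists z(Sz\wedge(\forall w)_O(Ewz\leftrightarrow(Ewx*Ewy))))$ 10. $\forall x\forall y((Sx\wedge Sy)\to\exists z(Sz\wedge(\forall w)_O(Ewz\leftrightarrow\forall u(Rwxu\to Euy))))$ 11. $\forall x\forall y((Sx\wedge Sy)\to\exists z(Sz\wedge(\forall w)_O(Ewz\leftrightarrow\exists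 u(Rwxu\wedge Euy))))$ 12. $\forall x\forall y((Sx\wedge Sy\wedge(\forall z)_O(Ezx\leftrightarrow Ezy))\to x\equiv y)$ **Standard translation.** For $x\in Ind$, $ST_x(p)=px$, $ST_x$ commutes with $\top,\bot,\wedge,\vee,\to$, and $$ST_x(\psi\,\Box\!\!\to\chi)=\exists y(Sy\wedge(\forall z)_O(Ezy\leftrightarrow ST_z(\psi))\wedge\forall w(Rxyw\to ST_w(\chi))),$$ $$ST_x(\psi\,\Diamond\!\!\to\chi)=\exists y(Sy\wedge(\forall z)_O(Ezy\leftrightarrow ST_z(\psi))\wedge\exists w(Rxyw\wedge ST_w(\chi))),$$ where, for each $x$, the bound variables $y,z,w$ are chosen in any way such that $x,y,z,w$ are pairwise distinct. **Theorem.** For every such choice of bound variables, all $\Gamma,\Delta\subseteq\mathcal L$ and every $x\in Ind$, $$\Gamma\models_{\mathsf{IntCK}}\Delta\quad\Longleftrightarrow\quad Th\cup\{ST_x(\phi)\mid\phi\in\Gamma\}\models_{fo}\{ST_x(\psi)\mid\psi\in\Delta\}.$$ -/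

import Mathlib

universe u

namespace CondLogic

/-! ### The propositional conditional language and its Chellas models -/

/-- Propositional variables (a countably infinite set). -/
abbrev Var : Type := ℕ

/-- Formulas of the conditional language over `⊥, ⊤, ∧, ∨, →` and the two conditionals
`boxto` (would) and `diamondto` (might). -/
inductive Form : Type
  | var (p : Var)
  | top
  | bot
  | and (φ ψ : Form)
  | or (φ ψ : Form)
  | imp (φ ψ : Form)
  | boxto (φ ψ : Form)
  | diamondto (φ ψ : Form)

/-- Intuitionistic Chellas models `(W, ≤, R, V)`. -/
structure Model : Type (u + 1) where
  /-- the worlds -/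
  W : Type u
  nonempty : Nonempty W
  /-- the pre-order -/
  le : W → W → Prop
  le_refl : ∀ w, le w w
  le_trans : ∀ w v z, le w v → le v z → le w z
  /-- the set-indexed accessibility: `R w X v` is `R_X(w, v)` -/
  R : W → Set W → W → Prop
  /-- the valuation -/
  V : Var → Set W
  V_mono : ∀ p w v, le w v → w ∈ V p → v ∈ V p
  /-- `(≤⁻¹ ∘ R_X) ⊆ (R_X ∘ ≤⁻¹)`, composition being read from left to right -/
  c1 : ∀ (X : Set W) (w w' v : W), le w w' → R w X v → ∃ v', R w' X v' ∧ le v v'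
  /-- `(R_X ∘ ≤) ⊆ (≤ ∘ R_X)` -/
  c2 : ∀ (X : Set W) (w v v' : W), R w X v → le v v' → ∃ w', le w w' ∧ R w' X v'

/-- The truth set `‖φ‖` of a formula in a model. -/
def Model.truthSet (M : Model.{u}) : Form → Set M.W
  | .var p => M.V p
  | .top => Set.univ
  | .bot => ∅
  | .and φ ψ => {w | w ∈ M.truthSet φ ∧ w ∈ M.truthSet ψ}
  | .or φ ψ => {w | w ∈ M.truthSet φ ∨ w ∈ M.truthSet ψ}
  | .imp φ ψ => {w | ∀ v, M.le w v → v ∈ M.truthSet φ → v ∈ M.truthSet ψ}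
  | .boxto φ ψ => {w | ∀ v, M.le w v → ∀ z, M.R v (M.truthSet φ) z → z ∈ M.truthSet ψ}
  | .diamondto φ ψ => {w | ∃ z, M.R w (M.truthSet φ) z ∧ z ∈ M.truthSet ψ}

/-- Satisfaction `M, w ⊨ φ`. -/
def Model.Sat (M : Model.{u}) (w : M.W) (φ : Form) : Prop := w ∈ M.truthSet φ

/-- `(Γ, Δ)` is satisfiable: some pointed model satisfies all of `Γ` and refutes all of `Δ`. -/
def Satisfiable (Γ Δ : Set Form) : Prop :=
  ∃ (M : Model.{u}) (w : M.W), (∀ φ ∈ Γ, M.Sat w φ) ∧ (∀ ψ ∈ Δ, ¬ M.Sat w ψ)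

/-- `Δ` follows from `Γ` in `IntCK`. -/
def Follows (Γ Δ : Set Form) : Prop := ¬ Satisfiable.{u} Γ Δ

/-! ### The first-order language and Kripke sheaves -/

/-- Individual variables. -/
abbrev Ind : Type := ℕ

/-- First-order formulas over the vocabulary `{p¹ | p ∈ Var} ∪ {R³, O¹, S¹, E²}` with equality. -/
inductive FO : Type
  | pred (p : Var) (x : Ind)
  | R (x y z : Ind)
  | O (x : Ind)
  | S (x : Ind)
  | E (x y : Ind)
  | eq (x y : Ind)
  | top
  | bot
  | and (φ ψ : FO)
  | or (φ ψ : FO)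
  | imp (φ ψ : FO)
  | all (x : Ind) (φ : FO)
  | ex (x : Ind) (φ : FO)

namespace FO

/-- Negation, `¬φ := φ → ⊥`. -/
def neg (φ : FO) : FO := imp φ bot

/-- Equivalence, `φ ↔ ψ := (φ → ψ) ∧ (ψ → φ)`. -/
def iff (φ ψ : FO) : FO := and (imp φ ψ) (imp ψ φ)

/-- The guarded quantifier `(∀x)_O φ := ∀x (Ox → φ)`. -/
def allO (x : Ind) (φ : FO) : FO := all x (imp (O x) φ)

end FO

/-- Intuitionistic Kripke sheaves over this vocabulary: a pre-ordered family of classical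
first-order structures with a functorial family of homomorphisms. -/
structure Sheaf : Type (u + 1) where
  /-- the nodes -/
  W : Type u
  nonempty : Nonempty W
  /-- the pre-order -/
  le : W → W → Prop
  le_refl : ∀ w, le w w
  le_trans : ∀ w v z, le w v → le v z → le w z
  /-- the domain at a node -/
  A : W → Type u
  A_nonempty : ∀ w, Nonempty (A w)
  /-- the interpretations of the predicates at a node -/
  iP : ∀ w, Var → A w → Prop
  iR : ∀ w, A w → A w → A w → Prop
  iO : ∀ w, A w → Prop
  iS : ∀ w, A w → Prop
  iE : ∀ w, A w → A w → Prop
  /-- the transition maps, which are homomorphisms -/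
  H : ∀ {w v}, le w v → A w → A v
  H_P : ∀ {w v} (h : le w v) (p : Var) (a : A w), iP w p a → iP v p (H h a)
  H_R : ∀ {w v} (h : le w v) (a b c : A w), iR w a b c → iR v (H h a) (H h b) (H h c)
  H_O : ∀ {w v} (h : le w v) (a : A w), iO w a → iO v (H h a)
  H_S : ∀ {w v} (h : le w v) (a : A w), iS w a → iS v (H h a)
  H_E : ∀ {w v} (h : le w v) (a b : A w), iE w a b → iE v (H h a) (H h b)
  H_id : ∀ (w : W) (h : le w w) (a : A w), H h a = a
  H_comp : ∀ {w v z} (h₁ : le w v) (h₂ : le v z) (h₃ : le w z) (a : A w),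
    H h₃ a = H h₂ (H h₁ a)

/-- Satisfaction `S, w ⊨ φ [f]` for a variable assignment `f` at the node `w`. -/
def Sheaf.Sat (S : Sheaf.{u}) : FO → (w : S.W) → (Ind → S.A w) → Prop
  | .pred p x, w, f => S.iP w p (f x)
  | .R x y z, w, f => S.iR w (f x) (f y) (f z)
  | .O x, w, f => S.iO w (f x)
  | .S x, w, f => S.iS w (f x)
  | .E x y, w, f => S.iE w (f x) (f y)
  | .eq x y, _, f => f x = f y
  | .top, _, _ => True
  | .bot, _, _ => False
  | .and φ ψ, w, f => S.Sat φ w f ∧ S.Sat ψ w f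
  | .or φ ψ, w, f => S.Sat φ w f ∨ S.Sat ψ w f
  | .imp φ ψ, w, f => ∀ (v : S.W) (h : S.le w v),
      S.Sat φ v (fun i => S.H h (f i)) → S.Sat ψ v (fun i => S.H h (f i))
  | .all x φ, w, f => ∀ (v : S.W) (h : S.le w v) (a : S.A v),
      S.Sat φ v (Function.update (fun i => S.H h (f i)) x a)
  | .ex x φ, w, f => ∃ a : S.A w, S.Sat φ w (Function.update f x a)

/-- `(Γ, Δ)` is first-order-satisfiable: at some node of some Kripke sheaf, under some
assignment of its elements to the variables, all of `Γ` and none of `Δ` is satisfied. -/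
def FOSatisfiable (Γ Δ : Set FO) : Prop :=
  ∃ (S : Sheaf.{u}) (w : S.W) (f : Ind → S.A w),
    (∀ φ ∈ Γ, S.Sat φ w f) ∧ (∀ ψ ∈ Δ, ¬ S.Sat ψ w f)

/-- `Δ` first-order-follows from `Γ`. -/
def FOFollows (Γ Δ : Set FO) : Prop := ¬ FOSatisfiable.{u} Γ Δ

/-! ### The two-sorted theory -/

open FO in
/-- The sentences of the two-sorted theory of objects and sets; the bound variables
`x, y, z, w, u` are `0, 1, 2, 3, 4`. -/
inductive IsAxiomOfTh : FO → Prop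
  /-- `∀x (Sx ∨ Ox)` -/
  | th1 : IsAxiomOfTh (all 0 (or (S 0) (O 0)))
  /-- `∀x ¬(Sx ∧ Ox)` -/
  | th2 : IsAxiomOfTh (all 0 (neg (and (S 0) (O 0))))
  /-- `∀x (px → Ox)` -/
  | th3 (p : Var) : IsAxiomOfTh (all 0 (imp (pred p 0) (O 0)))
  /-- `∀x ∀y (Exy → (Ox ∧ Sy))` -/
  | th4 : IsAxiomOfTh (all 0 (all 1 (imp (E 0 1) (and (O 0) (S 1)))))
  /-- `∀x ∀y ∀z (Rxyz → (Ox ∧ Sy ∧ Oz))` -/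
  | th5 : IsAxiomOfTh
      (all 0 (all 1 (all 2 (imp (R 0 1 2) (and (O 0) (and (S 1) (O 2)))))))
  /-- `∃x (Sx ∧ ∀y (Eyx ↔ py))` -/
  | th6 (p : Var) : IsAxiomOfTh (ex 0 (and (S 0) (all 1 (iff (E 1 0) (pred p 1)))))
  /-- `∃x (Sx ∧ (∀y)_O Eyx)` -/
  | th7 : IsAxiomOfTh (ex 0 (and (S 0) (allO 1 (E 1 0))))
  /-- `∃x (Sx ∧ ∀y ¬Eyx)` -/
  | th8 : IsAxiomOfTh (ex 0 (and (S 0) (all 1 (neg (E 1 0)))))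
  /-- `∀x ∀y ((Sx ∧ Sy) → ∃z (Sz ∧ (∀w)_O (Ewz ↔ (Ewx ∧ Ewy))))` -/
  | th9_and : IsAxiomOfTh (all 0 (all 1 (imp (and (S 0) (S 1))
      (ex 2 (and (S 2) (allO 3 (iff (E 3 2) (and (E 3 0) (E 3 1)))))))))
  /-- `∀x ∀y ((Sx ∧ Sy) → ∃z (Sz ∧ (∀w)_O (Ewz ↔ (Ewx ∨ Ewy))))` -/
  | th9_or : IsAxiomOfTh (all 0 (all 1 (imp (and (S 0) (S 1))
      (ex 2 (and (S 2) (allO 3 (iff (E 3 2) (or (E 3 0) (E 3 1)))))))))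
  /-- `∀x ∀y ((Sx ∧ Sy) → ∃z (Sz ∧ (∀w)_O (Ewz ↔ (Ewx → Ewy))))` -/
  | th9_imp : IsAxiomOfTh (all 0 (all 1 (imp (and (S 0) (S 1))
      (ex 2 (and (S 2) (allO 3 (iff (E 3 2) (imp (E 3 0) (E 3 1)))))))))
  /-- `∀x ∀y ((Sx ∧ Sy) → ∃z (Sz ∧ (∀w)_O (Ewz ↔ ∀u (Rwxu → Euy))))` -/
  | th10 : IsAxiomOfTh (all 0 (all 1 (imp (and (S 0) (S 1))
      (ex 2 (and (S 2) (allO 3 (iff (E 3 2) (all 4 (imp (R 3 0 4) (E 4 1))))))))))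
  /-- `∀x ∀y ((Sx ∧ Sy) → ∃z (Sz ∧ (∀w)_O (Ewz ↔ ∃u (Rwxu ∧ Euy))))` -/
  | th11 : IsAxiomOfTh (all 0 (all 1 (imp (and (S 0) (S 1))
      (ex 2 (and (S 2) (allO 3 (iff (E 3 2) (ex 4 (and (R 3 0 4) (E 4 1))))))))))
  /-- `∀x ∀y ((Sx ∧ Sy ∧ (∀z)_O (Ezx ↔ Ezy)) → x ≡ y)` -/
  | th12 : IsAxiomOfTh (all 0 (all 1 (imp
      (and (S 0) (and (S 1) (allO 2 (iff (E 2 0) (E 2 1))))) (eq 0 1))))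

/-- The theory `Th`. -/
def Th : Set FO := {φ | IsAxiomOfTh φ}

/-! ### The standard translation -/

/-- A choice, for every individual variable `x`, of three further variables `y x, z x, w x`
such that `x, y x, z x, w x` are pairwise distinct. -/
structure VarChoice : Type where
  y : Ind → Ind
  z : Ind → Ind
  w : Ind → Ind
  distinct : ∀ x, [x, y x, z x, w x].Nodup

/-- The standard `x`-translation, with bound variables named by `c`. -/
def stdTrans (c : VarChoice) : Ind → Form → FO
  | x, .var p => .pred p x
  | _, .top => .top
  | _, .bot => .bot
  | x, .and ψ χ => .and (stdTrans c x ψ) (stdTrans c x χ)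
  | x, .or ψ χ => .or (stdTrans c x ψ) (stdTrans c x χ)
  | x, .imp ψ χ => .imp (stdTrans c x ψ) (stdTrans c x χ)
  | x, .boxto ψ χ =>
      .ex (c.y x) (.and (.S (c.y x)) (.and
        (.allO (c.z x) (.iff (.E (c.z x) (c.y x)) (stdTrans c (c.z x) ψ)))
        (.all (c.w x) (.imp (.R x (c.y x) (c.w x)) (stdTrans c (c.w x) χ)))))
  | x, .diamondto ψ χ =>
      .ex (c.y x) (.and (.S (c.y x)) (.and
        (.allO (c.z x) (.iff (.E (c.z x) (c.y x)) (stdTrans c (c.z x) ψ)))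
        (.ex (c.w x) (.and (.R x (c.y x) (c.w x)) (stdTrans c (c.w x) χ)))))

end CondLogic

namespace CondLogic

/-! ### Satisfaction in Kripke sheaves -/

namespace Sheaf

variable (S : Sheaf.{u})

/-! Both consequence relations are negated satisfiability, so it suffices to pass between pointed
Chellas models and pointed sheaves satisfying `Th`, matching truth of a formula with satisfaction of
its translation.

From a sheaf, the worlds are pairs (node, element). An element reaches another of the same node via
`X` when `R` holds with some code of `X` in the middle. Homomorphy of the transition maps gives `c1`
and `c2`. Comprehension gives each truth set a code (`exists_codes_truthSet`), and extensionality
makes codes unique (`Codes.unique`), so the set quantified in the translation is the truth set.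

From a model, the difficulty is that transitions are functions preserving `R`, while `c1` only
yields some successor. The model is therefore unravelled: objects are names of paths, nodes are
labellings of names by worlds, and transitions fix names while labels grow. `R` says that one name
extends another, so it is preserved. The crux is `IsLabelling.exists_isFull`: any one label can be
raised to any larger world. Here `c2` carries the raise back to the root, `c1` carries it on to all
other names, and fresh names supply missing successors. So the later labels of an object are exactly
the worlds above its label (`forall_lift_iff`), and its successors realise exactly those of its
label (`forall_acc_iff`). -/

theorem H_refl_comp {w : S.W} (h : S.le w w) (f : Ind → S.A w) :
    (fun i => S.H h (f i)) = f :=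
  funext fun _ => S.H_id _ _ _

theorem H_H {w v z : S.W} (h₁ : S.le w v) (h₂ : S.le v z) (a : S.A w) :
    S.H h₂ (S.H h₁ a) = S.H (S.le_trans _ _ _ h₁ h₂) a :=
  (S.H_comp _ _ _ _).symm

theorem H_update {w v : S.W} (h : S.le w v) (f : Ind → S.A w) (x : Ind) (a : S.A w) :
    (fun i => S.H h (Function.update f x a i)) =
      Function.update (fun i => S.H h (f i)) x (S.H h a) := by
  funext i
  by_cases hi : i = x
  · subst hi; simp
  · simp [hi]

/-- The nested passages to later nodes, one for the quantifier and one for the implication, collapse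
by functoriality of the transition maps. -/
theorem sat_all_imp {φ ψ : FO} {x : Ind} {w : S.W} {f : Ind → S.A w} :
    S.Sat (.all x (.imp φ ψ)) w f ↔ ∀ (v : S.W) (h : S.le w v) (a : S.A v),
      S.Sat φ v (Function.update (fun i => S.H h (f i)) x a) →
      S.Sat ψ v (Function.update (fun i => S.H h (f i)) x a) := by
  constructor
  · intro H v h a
    simpa only [H_refl_comp] using H v h a v (S.le_refl v)
  · intro H v h a v' h'
    simp only [H_update, H_H]
    exact H v' _ _

theorem sat_all_iff {φ ψ : FO} {x : Ind} {w : S.W} {f : Ind → S.A w} :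
    S.Sat (.all x (.iff φ ψ)) w f ↔ ∀ (v : S.W) (h : S.le w v) (a : S.A v),
      (S.Sat φ v (Function.update (fun i => S.H h (f i)) x a) ↔
      S.Sat ψ v (Function.update (fun i => S.H h (f i)) x a)) := by
  have h1 : S.Sat (.all x (.iff φ ψ)) w f ↔
      S.Sat (.all x (.imp φ ψ)) w f ∧ S.Sat (.all x (.imp ψ φ)) w f :=
    ⟨fun H => ⟨fun v h a => (H v h a).1, fun v h a => (H v h a).2⟩,
      fun H v h a => ⟨H.1 v h a, H.2 v h a⟩⟩
  rw [h1, sat_all_imp, sat_all_imp]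
  exact ⟨fun H v h a => ⟨H.1 v h a, H.2 v h a⟩,
    fun H => ⟨fun v h a => (H v h a).1, fun v h a => (H v h a).2⟩⟩

theorem sat_allO_iff {φ ψ : FO} {x : Ind} {w : S.W} {f : Ind → S.A w} :
    S.Sat (.allO x (.iff φ ψ)) w f ↔ ∀ (v : S.W) (h : S.le w v) (a : S.A v), S.iO v a →
      (S.Sat φ v (Function.update (fun i => S.H h (f i)) x a) ↔
      S.Sat ψ v (Function.update (fun i => S.H h (f i)) x a)) := by
  rw [FO.allO, sat_all_imp]
  simp only [FO.iff, Sat, Function.update_self]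
  constructor
  · intro H v h a ha
    have := H v h a ha
    exact ⟨by simpa only [H_refl_comp] using this.1 v (S.le_refl v),
      by simpa only [H_refl_comp] using this.2 v (S.le_refl v)⟩
  · intro H v h a ha
    constructor <;> intro v' h' <;> simp only [H_update, H_H]
    · exact (H v' _ _ (S.H_O _ _ ha)).1
    · exact (H v' _ _ (S.H_O _ _ ha)).2

theorem Sat.all_all {φ : FO} {x y : Ind} (hxy : x ≠ y) {w : S.W} {f : Ind → S.A w}
    (H : S.Sat (.all x (.all y φ)) w f) {v : S.W} (h : S.le w v) (a b : S.A v) :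
    ∃ g : Ind → S.A v, g x = a ∧ g y = b ∧ S.Sat φ v g := by
  have := H v h a v (S.le_refl v) b
  rw [H_refl_comp] at this
  exact ⟨_, by simp [hxy], by simp, this⟩

/-! ### From Kripke sheaves to Chellas models -/

/-- The set element `s` at `w` has as its members, at all later nodes, exactly the objects
that form elements of `X` there. -/
def Codes (X : Set (Σ w, S.A w)) (w : S.W) (s : S.A w) : Prop :=
  S.iS w s ∧ ∀ (v : S.W) (h : S.le w v) (b : S.A v), S.iO v b →
    (S.iE v b (S.H h s) ↔ (⟨v, b⟩ : Σ w, S.A w) ∈ X)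

variable {S} in
theorem Codes.mono {X : Set (Σ w, S.A w)} {w v : S.W} {s : S.A w} (hs : S.Codes X w s)
    (h : S.le w v) : S.Codes X v (S.H h s) :=
  ⟨S.H_S _ _ hs.1, fun z hz b hb => by rw [H_H]; exact hs.2 z _ b hb⟩

/-- The order between the elements of the domains of a sheaf: every element lies below its
images. -/
inductive PointLE : (Σ w, S.A w) → (Σ w, S.A w) → Prop
  | image {w v : S.W} (h : S.le w v) (a : S.A w) : PointLE ⟨w, a⟩ ⟨v, S.H h a⟩

/-- The Chellas model whose worlds are the elements of the domains of a sheaf. -/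
abbrev toModel (w₀ : S.W) : Model.{u} where
  W := Σ w, S.A w
  nonempty := ⟨⟨w₀, (S.A_nonempty w₀).some⟩⟩
  le := S.PointLE
  le_refl p := by
    have := PointLE.image (S.le_refl p.1) p.2
    rwa [S.H_id] at this
  le_trans := by
    rintro _ _ _ ⟨h, a⟩ ⟨k, _⟩
    rw [H_H]
    exact ⟨_, _⟩
  -- A set without a code at the node has no successors there; only truth sets matter, and above
  -- `w₀` these have codes.
  R p X q := ∃ s b : S.A p.1, q = ⟨p.1, b⟩ ∧ S.Codes X p.1 s ∧ S.iR p.1 p.2 s b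
  V p := {a | S.iP a.1 p a.2}
  V_mono := by
    rintro p _ _ ⟨h, a⟩ ha
    exact S.H_P h p a ha
  -- For both conditions one transition map moves the whole triple.
  c1 := by
    rintro X _ _ _ ⟨h, a⟩ ⟨s, b, rfl, hs, hR⟩
    exact ⟨⟨_, S.H h b⟩, ⟨S.H h s, _, rfl, hs.mono h, S.H_R h _ _ _ hR⟩, ⟨h, b⟩⟩
  c2 := by
    rintro X ⟨w, a⟩ _ _ ⟨s, b, rfl, hs, hR⟩ ⟨h, _⟩
    exact ⟨⟨_, S.H h a⟩, ⟨h, a⟩, S.H h s, _, rfl, hs.mono h, S.H_R h _ _ _ hR⟩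

/-! ### Consequences of `Th`: codes of truth sets and the truth lemma -/

variable {S} {w₀ : S.W} {f₀ : Ind → S.A w₀} (hTh : ∀ φ ∈ Th, S.Sat φ w₀ f₀)

include hTh in
theorem Codes.unique {X : Set (Σ w, S.A w)} {w : S.W} (hw : S.le w₀ w) {s t : S.A w}
    (hs : S.Codes X w s) (ht : S.Codes X w t) : s = t := by
  obtain ⟨g, rfl, rfl, hg⟩ := Sat.all_all S (by decide) (hTh _ .th12) hw s t
  have := hg w (S.le_refl w)
  simp only [H_refl_comp] at this
  refine this ⟨hs.1, ht.1, ?_⟩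
  rw [sat_allO_iff]
  intro v h b hb
  simp only [Sat, Function.update_self, Function.update_of_ne, ne_eq,
    OfNat.zero_ne_ofNat, OfNat.one_ne_ofNat, not_false_eq_true]
  rw [hs.2 v h b hb, ht.2 v h b hb]

/-- The common shape of the binary comprehension axioms. Only the values of `g` at 0, 1, 3 are
recorded, since these are the free variables of each `θ` used. -/
theorem exists_set_of_axiom {θ : FO}
    (H : S.Sat (.all 0 (.all 1 (.imp (.and (.S 0) (.S 1))
      (.ex 2 (.and (.S 2) (.allO 3 (.iff (.E 3 2) θ))))))) w₀ f₀)
    {w : S.W} (hw : S.le w₀ w) {s t : S.A w} (hs : S.iS w s) (ht : S.iS w t) :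
    ∃ r, S.iS w r ∧ ∀ (v : S.W) (h : S.le w v) (b : S.A v), S.iO v b →
      ∃ g : Ind → S.A v, g 0 = S.H h s ∧ g 1 = S.H h t ∧ g 3 = b ∧
        (S.iE v b (S.H h r) ↔ S.Sat θ v g) := by
  obtain ⟨g, rfl, rfl, hg⟩ := Sat.all_all S (by decide) H hw s t
  have := hg w (S.le_refl w)
  simp only [H_refl_comp] at this
  obtain ⟨r, hr, hr'⟩ := this ⟨hs, ht⟩
  refine ⟨r, by simpa [Sat] using hr, fun v h b hb => ?_⟩
  have := S.sat_allO_iff.1 hr' v h b hb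
  refine ⟨_, ?_, ?_, ?_, Iff.trans ?_ this⟩ <;> simp [Sat]

-- Codes decide membership of objects only, so they say something about `R`-successors because these
-- are objects.
include hTh in
theorem R_sorts {w : S.W} (hw : S.le w₀ w) {a s b : S.A w} (h : S.iR w a s b) :
    S.iS w s ∧ S.iO w b := by
  obtain ⟨g, hg0, hg1, hg⟩ := Sat.all_all S (by decide) (hTh _ .th5) hw a s
  have := S.sat_all_imp.1 hg w (S.le_refl w) b
  simp only [H_refl_comp] at this
  simp only [Sat, Function.update_self, Function.update_of_ne, ne_eq,
    OfNat.zero_ne_ofNat, OfNat.one_ne_ofNat, not_false_eq_true, hg0, hg1] at this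
  exact (this h).2

-- Each connective has its comprehension axiom. For the conditionals, uniqueness identifies any code
-- met in the model's relation with the transported code from the induction hypothesis.
include hTh in
theorem exists_codes_truthSet (φ : Form) {w : S.W} (hw : S.le w₀ w) :
    ∃ s, S.Codes ((S.toModel w₀).truthSet φ) w s := by
  induction φ generalizing w with
  | var p =>
    obtain ⟨s, hs, hs'⟩ := hTh _ (.th6 p)
    rw [sat_all_iff] at hs'
    refine ⟨S.H hw s, Codes.mono ⟨by simpa [Sat] using hs, fun v h b _ => ?_⟩ hw⟩
    have := hs' v h b
    exact Iff.trans (by simp [Sat]) (this.trans (by simp [Sat, Model.truthSet]))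
  | top =>
    obtain ⟨s, hs, hs'⟩ := hTh _ .th7
    rw [FO.allO, sat_all_imp] at hs'
    refine ⟨S.H hw s, Codes.mono ⟨by simpa [Sat] using hs, fun v h b hb => ?_⟩ hw⟩
    have := hs' v h b
    exact iff_of_true (by simpa [Sat, hb] using this) trivial
  | bot =>
    obtain ⟨s, hs, hs'⟩ := hTh _ .th8
    rw [FO.neg, sat_all_imp] at hs'
    refine ⟨S.H hw s, Codes.mono ⟨by simpa [Sat] using hs, fun v h b hb => ?_⟩ hw⟩
    have := hs' v h b
    exact iff_of_false (by simpa [Sat] using this) id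
  | and φ ψ ihφ ihψ =>
    obtain ⟨s, hs⟩ := ihφ hw
    obtain ⟨t, ht⟩ := ihψ hw
    obtain ⟨r, hr, hr'⟩ := exists_set_of_axiom (hTh _ .th9_and) hw hs.1 ht.1
    refine ⟨r, hr, fun v h b hb => ?_⟩
    obtain ⟨g, h0, h1, h3, hg⟩ := hr' v h b hb
    simp only [Sat, h0, h1, h3, hs.2 v h b hb, ht.2 v h b hb] at hg
    exact hg
  | or φ ψ ihφ ihψ =>
    obtain ⟨s, hs⟩ := ihφ hw
    obtain ⟨t, ht⟩ := ihψ hw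
    obtain ⟨r, hr, hr'⟩ := exists_set_of_axiom (hTh _ .th9_or) hw hs.1 ht.1
    refine ⟨r, hr, fun v h b hb => ?_⟩
    obtain ⟨g, h0, h1, h3, hg⟩ := hr' v h b hb
    simp only [Sat, h0, h1, h3, hs.2 v h b hb, ht.2 v h b hb] at hg
    exact hg
  | imp φ ψ ihφ ihψ =>
    obtain ⟨s, hs⟩ := ihφ hw
    obtain ⟨t, ht⟩ := ihψ hw
    obtain ⟨r, hr, hr'⟩ := exists_set_of_axiom (hTh _ .th9_imp) hw hs.1 ht.1
    refine ⟨r, hr, fun v h b hb => ?_⟩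
    obtain ⟨g, h0, h1, h3, hg⟩ := hr' v h b hb
    simp only [Sat, h0, h1, h3, H_H] at hg
    rw [hg]
    constructor
    · rintro H ⟨v', _⟩ ⟨h', _⟩ hb'
      exact (ht.2 _ _ _ (S.H_O h' b hb)).1
        (H v' h' ((hs.2 _ _ _ (S.H_O h' b hb)).2 hb'))
    · intro H v' h' hE
      exact (ht.2 _ _ _ (S.H_O h' b hb)).2
        (H ⟨v', _⟩ ⟨h', _⟩ ((hs.2 _ _ _ (S.H_O h' b hb)).1 hE))
  | boxto φ ψ ihφ ihψ =>
    obtain ⟨s, hs⟩ := ihφ hw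
    obtain ⟨t, ht⟩ := ihψ hw
    obtain ⟨r, hr, hr'⟩ := exists_set_of_axiom (hTh _ .th10) hw hs.1 ht.1
    refine ⟨r, hr, fun v h b hb => ?_⟩
    obtain ⟨g, h0, h1, h3, hg⟩ := hr' v h b hb
    rw [sat_all_imp] at hg
    simp only [Sat, Function.update_self, Function.update_of_ne, ne_eq, Nat.reduceEqDiff,
      OfNat.zero_ne_ofNat, OfNat.one_ne_ofNat, not_false_eq_true,
      h0, h1, h3, H_H] at hg
    rw [hg]
    have hv : S.le w₀ v := S.le_trans _ _ _ hw h
    constructor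
    · rintro H ⟨v', _⟩ ⟨h', _⟩ _ ⟨s', c, rfl, hs', hR⟩
      have hv' : S.le w₀ v' := S.le_trans _ _ _ hv h'
      obtain rfl := Codes.unique hTh hv' hs' (hs.mono (S.le_trans _ _ _ h h'))
      exact (ht.2 _ _ _ (R_sorts hTh hv' hR).2).1 (H v' h' c hR)
    · intro H v' h' c hR
      have hv' : S.le w₀ v' := S.le_trans _ _ _ hv h'
      exact (ht.2 _ _ _ (R_sorts hTh hv' hR).2).2
        (H ⟨v', _⟩ ⟨h', _⟩ ⟨v', c⟩ ⟨_, c, rfl, hs.mono _, hR⟩)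
  | diamondto φ ψ ihφ ihψ =>
    obtain ⟨s, hs⟩ := ihφ hw
    obtain ⟨t, ht⟩ := ihψ hw
    obtain ⟨r, hr, hr'⟩ := exists_set_of_axiom (hTh _ .th11) hw hs.1 ht.1
    refine ⟨r, hr, fun v h b hb => ?_⟩
    obtain ⟨g, h0, h1, h3, hg⟩ := hr' v h b hb
    simp only [Sat, Function.update_self, Function.update_of_ne, ne_eq, Nat.reduceEqDiff,
      OfNat.zero_ne_ofNat, OfNat.one_ne_ofNat, not_false_eq_true,
      h0, h1, h3] at hg
    rw [hg]
    have hv : S.le w₀ v := S.le_trans _ _ _ hw h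
    constructor
    · rintro ⟨c, hR, hE⟩
      exact ⟨⟨v, c⟩, ⟨_, c, rfl, hs.mono h, hR⟩, (ht.2 _ _ _ (R_sorts hTh hv hR).2).1 hE⟩
    · rintro ⟨_, ⟨s', c, rfl, hs', hR⟩, hc⟩
      obtain rfl := Codes.unique hTh hv hs' (hs.mono h)
      exact ⟨c, hR, (ht.2 _ _ _ (R_sorts hTh hv hR).2).2 hc⟩

-- For `boxto`, uniqueness of codes serves one direction and existence the other. For `diamondto`
-- neither is needed: the model's relation already quantifies over codes at the same node.
include hTh in
theorem sat_stdTrans_iff (c : VarChoice) (φ : Form) (x : Ind) {w : S.W} (hw : S.le w₀ w)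
    (f : Ind → S.A w) :
    S.Sat (stdTrans c x φ) w f ↔
      (⟨w, f x⟩ : Σ w, S.A w) ∈ (S.toModel w₀).truthSet φ := by
  induction φ generalizing w x with
  | var p => rfl
  | top => exact iff_of_true trivial trivial
  | bot => rfl
  | and φ ψ ihφ ihψ => exact and_congr (ihφ x hw f) (ihψ x hw f)
  | or φ ψ ihφ ihψ => exact or_congr (ihφ x hw f) (ihψ x hw f)
  | imp φ ψ ihφ ihψ =>
    simp only [stdTrans, Sat]
    constructor
    · rintro H ⟨v, _⟩ ⟨h, _⟩ hb
      have hv := S.le_trans _ _ _ hw h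
      exact (ihψ x hv _).1 (H v h ((ihφ x hv _).2 hb))
    · intro H v h hs
      have hv := S.le_trans _ _ _ hw h
      exact (ihψ x hv _).2 (H ⟨v, _⟩ ⟨h, _⟩ ((ihφ x hv _).1 hs))
  | boxto φ ψ ihφ ihψ =>
    have hd := c.distinct x
    simp only [List.nodup_cons, List.mem_cons, not_or, List.not_mem_nil,
      not_false_eq_true, and_true] at hd
    obtain ⟨⟨hxy, hxz, hxw⟩, ⟨hyz, hyw⟩, hzw, -⟩ := hd
    have key (s : S.A w) : S.Sat (.and (.S (c.y x)) (.and
        (.allO (c.z x) (.iff (.E (c.z x) (c.y x)) (stdTrans c (c.z x) φ)))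
        (.all (c.w x) (.imp (.R x (c.y x) (c.w x)) (stdTrans c (c.w x) ψ))))) w
          (Function.update f (c.y x) s) ↔
        S.Codes ((S.toModel w₀).truthSet φ) w s ∧ ∀ (v : S.W) (h : S.le w v) (b : S.A v),
          S.iR v (S.H h (f x)) (S.H h s) b →
            (⟨v, b⟩ : Σ w, S.A w) ∈ (S.toModel w₀).truthSet ψ := by
      change (_ ∧ S.Sat (.allO _ _) _ _ ∧ S.Sat (.all _ _) _ _) ↔ _
      rw [sat_allO_iff, sat_all_imp, ← and_assoc]
      refine and_congr (and_congr (by simp [Sat]) ?_) ?_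
      · refine forall_congr' fun v => forall_congr' fun h => forall_congr' fun b =>
          imp_congr Iff.rfl (iff_congr ?_ ?_)
        · simp [Sat, hyz]
        · rw [ihφ _ (S.le_trans _ _ _ hw h)]; simp
      · refine forall_congr' fun v => forall_congr' fun h => forall_congr' fun b =>
          imp_congr ?_ ?_
        · simp [Sat, hxw, hyw, hxy]
        · rw [ihψ _ (S.le_trans _ _ _ hw h)]; simp
    simp only [stdTrans]
    rw [Sat]
    simp only [key]
    constructor
    · rintro ⟨s, hs, H⟩ ⟨v, _⟩ ⟨h, _⟩ _ ⟨s', d, rfl, hs', hR⟩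
      obtain rfl := Codes.unique hTh (S.le_trans _ _ _ hw h) hs' (hs.mono h)
      exact H v h d hR
    · intro H
      obtain ⟨s, hs⟩ := exists_codes_truthSet hTh φ hw
      exact ⟨s, hs, fun v h b hR => H ⟨v, _⟩ ⟨h, _⟩ ⟨v, b⟩ ⟨_, b, rfl, hs.mono h, hR⟩⟩
  | diamondto φ ψ ihφ ihψ =>
    have hd := c.distinct x
    simp only [List.nodup_cons, List.mem_cons, not_or, List.not_mem_nil,
      not_false_eq_true, and_true] at hd
    obtain ⟨⟨hxy, hxz, hxw⟩, ⟨hyz, hyw⟩, hzw, -⟩ := hd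
    have key (s : S.A w) : S.Sat (.and (.S (c.y x)) (.and
        (.allO (c.z x) (.iff (.E (c.z x) (c.y x)) (stdTrans c (c.z x) φ)))
        (.ex (c.w x) (.and (.R x (c.y x) (c.w x)) (stdTrans c (c.w x) ψ))))) w
          (Function.update f (c.y x) s) ↔
        S.Codes ((S.toModel w₀).truthSet φ) w s ∧ ∃ b : S.A w,
          S.iR w (f x) s b ∧ (⟨w, b⟩ : Σ w, S.A w) ∈ (S.toModel w₀).truthSet ψ := by
      change (_ ∧ S.Sat (.allO _ _) _ _ ∧ S.Sat (.ex _ _) _ _) ↔ _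
      rw [sat_allO_iff, ← and_assoc]
      refine and_congr (and_congr (by simp [Sat]) ?_) ?_
      · refine forall_congr' fun v => forall_congr' fun h => forall_congr' fun b =>
          imp_congr Iff.rfl (iff_congr ?_ ?_)
        · simp [Sat, hyz]
        · rw [ihφ _ (S.le_trans _ _ _ hw h)]; simp
      · refine exists_congr fun b => and_congr ?_ ?_
        · simp [Sat, hxw, hyw, hxy]
        · rw [ihψ _ hw]; simp
    simp only [stdTrans]
    rw [Sat]
    simp only [key]
    constructor
    · rintro ⟨s, hs, b, hR, hb⟩
      exact ⟨⟨w, b⟩, ⟨s, b, rfl, hs, hR⟩, hb⟩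
    · rintro ⟨_, ⟨s, b, rfl, hs, hR⟩, hb⟩
      exact ⟨s, hs, b, hR, hb⟩

end Sheaf
/-! ### From Chellas models to Kripke sheaves -/

namespace Model

variable (M : Model.{u})

theorem truthSet_mono (φ : Form) : ∀ w v, M.le w v → w ∈ M.truthSet φ → v ∈ M.truthSet φ := by
  induction φ with
  | var p => exact M.V_mono p
  | top => exact fun _ _ _ _ => trivial
  | bot => exact fun _ _ _ h => h
  | and φ ψ ihφ ihψ => exact fun w v h hw => ⟨ihφ w v h hw.1, ihψ w v h hw.2⟩
  | or φ ψ ihφ ihψ => exact fun w v h hw => hw.imp (ihφ w v h) (ihψ w v h)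
  | imp φ ψ => exact fun w v h hw z hz => hw z (M.le_trans _ _ _ h hz)
  | boxto φ ψ => exact fun w v h hw z hz => hw z (M.le_trans _ _ _ h hz)
  | diamondto φ ψ _ ih =>
    rintro w v h ⟨z, hR, hz⟩
    obtain ⟨z', hR', hz'⟩ := M.c1 _ w v z h hR
    exact ⟨z', hR', ih _ _ hz' hz⟩

/-- One step of accessibility, labelled by a set of worlds or by `none`, the latter label
standing for the total relation. -/
def Step : Option (Set M.W) → M.W → M.W → Prop
  | none, _, _ => True
  | some X, w, v => M.R w X v

variable {M}

/-- The total relation trivially satisfies both frame conditions, so the label `none` is handled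
like a set. -/
theorem Step.forth {k : Option (Set M.W)} {w w' v : M.W} (h : M.le w w') (hv : M.Step k w v) :
    ∃ v', M.Step k w' v' ∧ M.le v v' := by
  cases k with
  | none => exact ⟨v, trivial, M.le_refl v⟩
  | some X => exact M.c1 X w w' v h hv

theorem Step.back {k : Option (Set M.W)} {w v v' : M.W} (hv : M.Step k w v) (h : M.le v v') :
    ∃ w', M.le w w' ∧ M.Step k w' v' := by
  cases k with
  | none => exact ⟨w, M.le_refl w, trivial⟩
  | some X => exact M.c2 X w v v' hv h

/-! ### Labellings of names and the raising of a single label -/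

variable (M)

/-- Names of objects: finite sequences of labelled steps, the last step first. Each step
carries a world and a level, which keep apart the different objects that are reached by it. -/
abbrev Name : Type u := List (Option (Set M.W) × M.W × ℕ)

variable {M}

/-- `m` assigns worlds to names of level below `n`, starting from the empty name, in such a way
that consecutive names are linked by the corresponding step. -/
structure IsLabelling (n : ℕ) (m : M.Name → Option M.W) : Prop where
  root : ∃ w, m [] = some w
  step : ∀ a ρ v, m (a :: ρ) = some v → a.2.2 < n ∧ ∃ u, m ρ = some u ∧ M.Step a.1 u v

/-- A labelling of bounded level in which all possible steps are taken. -/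
def IsFull (m : M.Name → Option M.W) : Prop :=
  (∃ n, IsLabelling n m) ∧ ∀ ρ k u v, m ρ = some u → M.Step k u v →
    ∃ t, m ((k, t) :: ρ) = some v

/-- The pointwise order of partial assignments. -/
def LabelLE (m m' : M.Name → Option M.W) : Prop :=
  ∀ σ w, m σ = some w → ∃ w', m' σ = some w' ∧ M.le w w'

/-- A partial prescription of larger values for a labelling `m`. -/
structure IsRaise (m p : M.Name → Option M.W) : Prop where
  root : ∃ w, p [] = some w
  ge : ∀ σ v, p σ = some v → ∃ u, m σ = some u ∧ M.le u v
  step : ∀ a ρ v, p (a :: ρ) = some v → ∃ u, p ρ = some u ∧ M.Step a.1 u v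

/-- Induction along the path to the root: `c2` replaces the predecessor by a larger one that reaches
the raised value. -/
theorem exists_isRaise {n : ℕ} {m : M.Name → Option M.W} (hm : IsLabelling n m)
    (σ : M.Name) {u v : M.W} (hu : m σ = some u) (huv : M.le u v) :
    ∃ p, IsRaise m p ∧ p σ = some v ∧ ∀ ρ : M.Name, σ.length < ρ.length → p ρ = none := by
  classical
  induction σ generalizing u v with
  | nil =>
    refine ⟨Function.update (fun _ => none) [] (some v), ⟨⟨v, by simp⟩, ?_, ?_⟩, by simp, ?_⟩
    · intro σ v' h
      by_cases hσ : σ = []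
      · subst hσ
        obtain rfl : v = v' := by simpa using h
        exact ⟨u, hu, huv⟩
      · simp [hσ] at h
    · intro a ρ v' h
      simp at h
    · intro ρ hρ
      have : ρ ≠ [] := by rintro rfl; simp at hρ
      simp [this]
  | cons a σ ih =>
    obtain ⟨-, u', hu', hstep⟩ := hm.step a σ u hu
    obtain ⟨w', hw', hstep'⟩ := hstep.back huv
    obtain ⟨p, hp, hpσ, hlen⟩ := ih hu' hw'
    -- By the length bound `p` is undefined at `a :: σ`, so the update overwrites no value.
    have hne {ρ : M.Name} {w : M.W} (h : p ρ = some w) : ρ ≠ a :: σ := by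
      rintro rfl
      rw [hlen _ (by simp)] at h
      cases h
    refine ⟨Function.update p (a :: σ) (some v), ⟨?_, ?_, ?_⟩, by simp, ?_⟩
    · simpa using hp.root
    · intro τ v' h
      by_cases hτ : τ = a :: σ
      · subst hτ
        obtain rfl : v = v' := by simpa using h
        exact ⟨u, hu, huv⟩
      · exact hp.ge τ v' (by simpa [hτ] using h)
    · intro b ρ v' h
      by_cases hb : b :: ρ = a :: σ
      · obtain ⟨rfl, rfl⟩ := List.cons.inj hb
        obtain rfl : v = v' := by simpa using h
        exact ⟨w', by rw [Function.update_of_ne (hne hpσ), hpσ], hstep'⟩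
      · rw [Function.update_of_ne hb] at h
        obtain ⟨u'', h1, h2⟩ := hp.step b ρ v' h
        exact ⟨u'', by rw [Function.update_of_ne (hne h1), h1], h2⟩
    · intro ρ hρ
      have : ρ ≠ a :: σ := by rintro rfl; simp at hρ
      rw [Function.update_of_ne this]
      exact hlen ρ (by simp at hρ; omega)

open Classical in
/-- The full labelling above `m` with the values prescribed by `p`, where new names have
level `n`. -/
noncomputable def extend (n : ℕ) (m p : M.Name → Option M.W) : M.Name → Option M.W
  | [] => p []
  | a :: ρ =>
    if (p (a :: ρ)).isSome then p (a :: ρ)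
    else if h : ∃ v r u, extend n m p ρ = some r ∧ M.Step a.1 r v ∧
        m (a :: ρ) = some u ∧ M.le u v then some h.choose
    -- A fresh name takes as value the world stored in its own last step.
    else if a.2.2 = n ∧ ∃ r, extend n m p ρ = some r ∧ M.Step a.1 r a.2.1 then some a.2.1
    else none

section Extend

variable {n : ℕ} {m p : M.Name → Option M.W} (hm : IsLabelling n m) (hp : IsRaise m p)

theorem extend_eq_of_isRaise {σ : M.Name} {v : M.W} (h : p σ = some v) :
    extend n m p σ = some v := by
  cases σ with
  | nil => exact h
  | cons a ρ => rw [extend, if_pos (by simp [h]), h]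

-- An old name outside `p` never loses its value: once its predecessor is raised, `Step.forth`
-- supplies a candidate for the choice in `extend`.
include hm hp in
theorem labelLE_extend : LabelLE m (extend n m p) := by
  intro σ
  induction σ with
  | nil =>
    intro w hw
    obtain ⟨v, hv⟩ := hp.root
    obtain ⟨u, hu, huv⟩ := hp.ge _ _ hv
    rw [hw] at hu
    cases hu
    exact ⟨v, hv, huv⟩
  | cons a ρ ih =>
    intro w hw
    obtain ⟨-, u, hu, hstep⟩ := hm.step _ _ _ hw
    obtain ⟨r, hr, hur⟩ := ih u hu
    obtain ⟨v, hv, hwv⟩ := hstep.forth hur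
    by_cases hpa : (p (a :: ρ)).isSome
    · obtain ⟨v', hv'⟩ := Option.isSome_iff_exists.1 hpa
      obtain ⟨w', hw', hle⟩ := hp.ge _ _ hv'
      rw [hw] at hw'
      cases hw'
      exact ⟨v', extend_eq_of_isRaise hv', hle⟩
    · have h : ∃ v r u, extend n m p ρ = some r ∧ M.Step a.1 r v ∧
        m (a :: ρ) = some u ∧ M.le u v := ⟨v, r, w, hr, hv, hw, hwv⟩
      rw [extend, if_neg hpa, dif_pos h]
      obtain ⟨_, w', -, -, hw', hle⟩ := h.choose_spec
      rw [hw] at hw'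
      cases hw'
      exact ⟨_, rfl, hle⟩

include hm hp in
theorem isLabelling_extend : IsLabelling (n + 1) (extend n m p) := by
  refine ⟨hp.root, fun a ρ v hv => ?_⟩
  rw [extend] at hv
  split_ifs at hv with h1 h2 h3
  · obtain ⟨u, hu, -⟩ := hp.ge _ _ hv
    obtain ⟨u', hu', hs⟩ := hp.step _ _ _ hv
    exact ⟨(hm.step _ _ _ hu).1.trans n.lt_succ_self, u', extend_eq_of_isRaise hu', hs⟩
  · obtain ⟨r, u, hr, hs, hu, -⟩ := h2.choose_spec
    cases hv
    exact ⟨(hm.step _ _ _ hu).1.trans n.lt_succ_self, r, hr, hs⟩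
  · cases hv
    exact ⟨by omega, h3.2⟩

include hm hp in
theorem isFull_extend : IsFull (extend n m p) := by
  refine ⟨⟨_, isLabelling_extend hm hp⟩, fun ρ k u v hu hs => ⟨(v, n), ?_⟩⟩
  -- Levels in `m` are below `n`, so this name is new and `extend` gives it the value `v`.
  have hmn : ∀ w, m ((k, v, n) :: ρ) ≠ some w := fun w hw =>
    absurd (hm.step _ _ _ hw).1 (lt_irrefl n)
  rw [extend, if_neg, dif_neg, if_pos ⟨rfl, u, hu, hs⟩]
  · rintro ⟨_, _, w, -, -, hw, -⟩
    exact hmn w hw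
  · rw [Option.isSome_iff_exists]
    rintro ⟨w, hw⟩
    obtain ⟨w', hw', -⟩ := hp.ge _ _ hw
    exact hmn w' hw'

end Extend

theorem IsLabelling.exists_isFull {n : ℕ} {m : M.Name → Option M.W} (hm : IsLabelling n m)
    {σ : M.Name} {u v : M.W} (hu : m σ = some u) (huv : M.le u v) :
    ∃ m', IsFull m' ∧ LabelLE m m' ∧ m' σ = some v := by
  obtain ⟨p, hp, hv, -⟩ := exists_isRaise hm σ hu huv
  exact ⟨_, isFull_extend hm hp, labelLE_extend hm hp, extend_eq_of_isRaise hv⟩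

theorem exists_isFull_root (w : M.W) : ∃ m : M.Name → Option M.W, IsFull m ∧ m [] = some w := by
  classical
  have hm : IsLabelling 0 (Function.update (fun _ : M.Name => none) [] (some w)) :=
    ⟨⟨w, by simp⟩, fun a ρ v h => by simp at h⟩
  obtain ⟨m, h, -, h'⟩ := hm.exists_isFull (σ := []) (u := w) (by simp) (M.le_refl w)
  exact ⟨m, h, h'⟩

/-! ### Nodes, objects and their worlds -/

variable (M)

/-- The nodes of the sheaf of a Chellas model. -/
abbrev Node : Type u := {m : M.Name → Option M.W // IsFull m}

/-- The upward closed sets of worlds. -/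
abbrev UpSet : Type u := {X : Set M.W // ∀ w v, M.le w v → w ∈ X → v ∈ X}

variable {M}

/-- The objects at a node are the names which have been assigned a world. -/
abbrev Node.Obj (N : M.Node) : Type u := {σ : M.Name // (N.1 σ).isSome}

namespace Node

/-- The world of an object at a node. -/
def world {N : M.Node} (σ : N.Obj) : M.W := (N.1 σ.1).get σ.2

theorem eq_some_world {N : M.Node} (σ : N.Obj) : N.1 σ.1 = some (world σ) :=
  (Option.some_get σ.2).symm

theorem exists_obj {N : M.Node} {σ : M.Name} {w : M.W} (h : N.1 σ = some w) :
    ∃ τ : N.Obj, τ.1 = σ ∧ world τ = w :=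
  ⟨⟨σ, by simp [h]⟩, rfl, by simp [world, h]⟩

/-- The transition from the objects of a node to those of a later one. -/
def lift {N N' : M.Node} (h : LabelLE N.1 N'.1) (σ : N.Obj) : N'.Obj :=
  ⟨σ.1, by obtain ⟨w, hw, -⟩ := h _ _ (eq_some_world σ); simp [hw]⟩

theorem le_world_lift {N N' : M.Node} (h : LabelLE N.1 N'.1) (σ : N.Obj) :
    M.le (world σ) (world (lift h σ)) := by
  obtain ⟨w, hw, hle⟩ := h _ _ (eq_some_world σ)
  have := eq_some_world (lift h σ)
  rw [show N'.1 (lift h σ).1 = some w from hw] at this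
  rwa [← Option.some.inj this]

/-- Accessibility between the objects of a node. -/
def Acc {N : M.Node} (σ : N.Obj) (X : M.UpSet) (τ : N.Obj) : Prop :=
  ∃ t, τ.1 = (some X.1, t) :: σ.1

theorem Acc.rel {N : M.Node} {σ τ : N.Obj} {X : M.UpSet} (h : Acc σ X τ) :
    M.R (world σ) X.1 (world τ) := by
  obtain ⟨t, ht⟩ := h
  obtain ⟨n, hn⟩ := N.2.1
  have := eq_some_world τ
  rw [ht] at this
  obtain ⟨-, u, hu, hs⟩ := hn.step _ _ _ this
  rw [eq_some_world σ] at hu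
  cases hu
  exact hs

theorem exists_acc {N : M.Node} (σ : N.Obj) (X : M.UpSet) {v : M.W}
    (h : M.R (world σ) X.1 v) : ∃ τ : N.Obj, Acc σ X τ ∧ world τ = v := by
  obtain ⟨t, ht⟩ := N.2.2 σ.1 (some X.1) _ v (eq_some_world σ) h
  obtain ⟨τ, h1, h2⟩ := exists_obj ht
  exact ⟨τ, ⟨t, h1⟩, h2⟩

/-- The purpose of the label `none`: a total step from the root reaches every world, so a set is
determined by its members at a single node. -/
theorem world_surjective (N : M.Node) : Function.Surjective (world : N.Obj → M.W) := by
  intro v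
  obtain ⟨n, hn⟩ := N.2.1
  obtain ⟨u, hu⟩ := hn.root
  obtain ⟨t, ht⟩ := N.2.2 [] none u v hu trivial
  obtain ⟨τ, -, h⟩ := exists_obj ht
  exact ⟨τ, h⟩

theorem exists_world_lift {N : M.Node} (σ : N.Obj) {v : M.W} (h : M.le (world σ) v) :
    ∃ (N' : M.Node) (h : LabelLE N.1 N'.1), world (lift h σ) = v := by
  obtain ⟨n, hn⟩ := N.2.1
  obtain ⟨m', h1, h2, h3⟩ := hn.exists_isFull (eq_some_world σ) h
  refine ⟨⟨m', h1⟩, h2, Option.some.inj ?_⟩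
  rw [← eq_some_world, ← h3]
  rfl

theorem forall_lift_iff {N : M.Node} (σ : N.Obj) (Q : M.W → Prop) :
    (∀ (N' : M.Node) (h : LabelLE N.1 N'.1), Q (world (lift h σ))) ↔
      ∀ v, M.le (world σ) v → Q v := by
  constructor
  · intro H v hv
    obtain ⟨N', h, rfl⟩ := exists_world_lift σ hv
    exact H N' h
  · exact fun H N' h => H _ (le_world_lift h σ)

theorem forall_acc_iff {N : M.Node} (σ : N.Obj) (X : M.UpSet) (Y : Set M.W) :
    (∀ τ : N.Obj, Acc σ X τ → world τ ∈ Y) ↔ ∀ v, M.R (world σ) X.1 v → v ∈ Y := by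
  constructor
  · intro H v hv
    obtain ⟨τ, hτ, rfl⟩ := exists_acc σ X hv
    exact H τ hτ
  · exact fun H τ hτ => H _ hτ.rel

theorem exists_acc_iff {N : M.Node} (σ : N.Obj) (X : M.UpSet) (Y : Set M.W) :
    (∃ τ : N.Obj, Acc σ X τ ∧ world τ ∈ Y) ↔ ∃ v, M.R (world σ) X.1 v ∧ v ∈ Y := by
  constructor
  · rintro ⟨τ, hτ, h⟩
    exact ⟨_, hτ.rel, h⟩
  · rintro ⟨v, hv, h⟩
    obtain ⟨τ, hτ, rfl⟩ := exists_acc σ X hv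
    exact ⟨τ, hτ, h⟩

end Node

open Node

variable (M)

/-- The Kripke sheaf of a Chellas model: its set elements are the upward closed sets of
worlds. -/
def toSheaf : Sheaf.{u} where
  W := M.Node
  nonempty := by
    obtain ⟨m, hm, -⟩ := exists_isFull_root M.nonempty.some
    exact ⟨⟨m, hm⟩⟩
  le N N' := LabelLE N.1 N'.1
  le_refl N σ w h := ⟨w, h, M.le_refl w⟩
  le_trans N N' N'' h h' σ w hw := by
    obtain ⟨w', hw', hle⟩ := h σ w hw
    obtain ⟨w'', hw'', hle'⟩ := h' σ w' hw'
    exact ⟨w'', hw'', M.le_trans _ _ _ hle hle'⟩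
  A N := N.Obj ⊕ M.UpSet
  A_nonempty _ := ⟨.inr ⟨∅, fun _ _ _ h => h⟩⟩
  iP _ p
    | .inl σ => world σ ∈ M.V p
    | .inr _ => False
  iR _
    | .inl σ, .inr X, .inl τ => Acc σ X τ
    | _, _, _ => False
  iO _ a := a.isLeft
  iS _ a := a.isRight
  iE _
    | .inl σ, .inr X => world σ ∈ X.1
    | _, _ => False
  H h := Sum.map (lift h) id
  H_P := by
    rintro N N' h p (σ | X) H
    · exact M.V_mono _ _ _ (le_world_lift h σ) H
    · exact H
  H_R := by
    -- Accessibility depends on names alone, and `lift` leaves names unchanged.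
    rintro N N' h (σ | X) (σ' | X') (σ'' | X'') H
    all_goals first | exact H.elim | exact H
  H_O := by rintro N N' h (σ | X) H <;> exact H
  H_S := by rintro N N' h (σ | X) H <;> exact H
  H_E := by
    rintro N N' h (σ | X) (σ' | X') H
    -- Membership persists because set elements are upward closed.
    all_goals first | exact X'.2 _ _ (le_world_lift h σ) H | exact H.elim
  H_id := by rintro N h (σ | X) <;> rfl
  H_comp := by rintro N N' N'' h₁ h₂ h₃ (σ | X) <;> rfl

variable {M}

/-! ### `Th` and the standard translation in the sheaf of a model -/

theorem exists_eq_inr {N : M.toSheaf.W} {a : M.toSheaf.A N} (h : M.toSheaf.iS N a) :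
    ∃ X : M.UpSet, a = .inr X := by
  rcases a with σ | X
  · cases h
  · exact ⟨X, rfl⟩

variable (M) in
/-- An upward closed set as an element at a node. -/
def setElem (N : M.toSheaf.W) (X : M.UpSet) : M.toSheaf.A N := .inr X

/-- One `Z` serves at all later nodes, as transitions fix set elements. -/
theorem sat_comprehension {θ : FO} {N : M.toSheaf.W} {g : Ind → M.toSheaf.A N} (Z : M.UpSet)
    (h : ∀ (N' : M.toSheaf.W) (hN : M.toSheaf.le N N') (σ : N'.Obj) (g' : Ind → M.toSheaf.A N'),
      g' 0 = M.toSheaf.H hN (g 0) → g' 1 = M.toSheaf.H hN (g 1) → g' 3 = .inl σ →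
      (world σ ∈ Z.1 ↔ M.toSheaf.Sat θ N' g')) :
    M.toSheaf.Sat (.ex 2 (.and (.S 2) (.allO 3 (.iff (.E 3 2) θ)))) N g := by
  refine ⟨setElem M N Z, rfl, M.toSheaf.sat_allO_iff.2 ?_⟩
  rintro N' hN (σ | X) hO
  · refine Iff.trans ?_ (h N' hN σ _ ?_ ?_ ?_)
    · exact Iff.rfl
    · rfl
    · rfl
    · rfl
  · cases hO

theorem sat_forall_sets {φ : FO} {N : M.toSheaf.W} {f : Ind → M.toSheaf.A N}
    (h : ∀ (N : M.toSheaf.W) (g : Ind → M.toSheaf.A N) (X Y : M.UpSet),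
      g 0 = .inr X → g 1 = .inr Y → M.toSheaf.Sat φ N g) :
    M.toSheaf.Sat (.all 0 (.all 1 (.imp (.and (.S 0) (.S 1)) φ))) N f := by
  intro _ _ _ _ _ _ N' _ hs
  obtain ⟨X, hX⟩ := exists_eq_inr hs.1
  obtain ⟨Y, hY⟩ := exists_eq_inr hs.2
  exact h N' _ X Y hX hY

theorem toSheaf_sat_th {φ : FO} (hφ : φ ∈ Th) (N : M.toSheaf.W) (f : Ind → M.toSheaf.A N) :
    M.toSheaf.Sat φ N f := by
  cases hφ with
  | th1 =>
    rintro N' _ (σ | X)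
    · exact Or.inr rfl
    · exact Or.inl rfl
  | th2 =>
    rw [FO.neg, Sheaf.sat_all_imp]
    rintro N' _ (σ | X) ⟨h, h'⟩
    · cases h
    · cases h'
  | th3 p =>
    rw [Sheaf.sat_all_imp]
    rintro N' _ (σ | X) h
    · rfl
    · cases h
  | th4 =>
    intro _ _ a
    rw [Sheaf.sat_all_imp]
    rintro N' h b
    simp only [Sheaf.Sat, Function.update_self, Function.update_of_ne, ne_eq, zero_ne_one,
      not_false_eq_true]
    generalize M.toSheaf.H h _ = a'
    intro hE
    rcases a' with σ | X <;> rcases b with σ' | X'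
    all_goals first | exact hE.elim | exact ⟨rfl, rfl⟩
  | th5 =>
    intro _ _ a _ h' b
    rw [Sheaf.sat_all_imp]
    rintro N' h c
    simp only [Sheaf.Sat, Function.update_self, Function.update_of_ne, ne_eq, zero_ne_one,
      OfNat.zero_ne_ofNat, OfNat.one_ne_ofNat, not_false_eq_true]
    generalize M.toSheaf.H h b = b'
    generalize M.toSheaf.H h _ = a'
    intro hR
    rcases a' with σ | X <;> rcases b' with σ' | X' <;> rcases c with σ'' | X''
    all_goals first | exact hR.elim | exact ⟨rfl, rfl, rfl⟩
  | th6 p =>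
    refine ⟨.inr ⟨M.V p, M.V_mono p⟩, rfl, M.toSheaf.sat_all_iff.2 ?_⟩
    rintro N' h (σ | X) <;> exact Iff.rfl
  | th7 =>
    refine ⟨.inr ⟨Set.univ, fun _ _ _ _ => trivial⟩, rfl, M.toSheaf.sat_all_imp.2 ?_⟩
    rintro N' h (σ | X) hO
    · exact trivial
    · cases hO
  | th8 =>
    refine ⟨.inr ⟨∅, fun _ _ _ h => h⟩, rfl, M.toSheaf.sat_all_imp.2 ?_⟩
    rintro N' h (σ | X) <;> exact id
  | th9_and =>
    refine sat_forall_sets fun N g X Y hX hY => sat_comprehension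
      ⟨X.1 ∩ Y.1, fun w v h hw => ⟨X.2 w v h hw.1, Y.2 w v h hw.2⟩⟩ fun N' h σ g' h0 h1 h3 => ?_
    simp only [Sheaf.Sat, h0, h1, h3, hX, hY]
    rfl
  | th9_or =>
    refine sat_forall_sets fun N g X Y hX hY => sat_comprehension
      ⟨X.1 ∪ Y.1, fun w v h hw => hw.imp (X.2 w v h) (Y.2 w v h)⟩ fun N' h σ g' h0 h1 h3 => ?_
    simp only [Sheaf.Sat, h0, h1, h3, hX, hY]
    rfl
  | th9_imp =>
    refine sat_forall_sets fun N g X Y hX hY => sat_comprehension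
      ⟨{w | ∀ v, M.le w v → v ∈ X.1 → v ∈ Y.1},
        fun w v h hw z hz => hw z (M.le_trans _ _ _ h hz)⟩ fun N' h σ g' h0 h1 h3 => ?_
    simp only [Sheaf.Sat, h0, h1, h3, hX, hY]
    exact (forall_lift_iff σ fun v => v ∈ X.1 → v ∈ Y.1).symm
  | th10 =>
    refine sat_forall_sets fun N g X Y hX hY => sat_comprehension
      ⟨{w | ∀ v, M.le w v → ∀ z, M.R v X.1 z → z ∈ Y.1},
        fun w v h hw z hz => hw z (M.le_trans _ _ _ h hz)⟩ fun N' h σ g' h0 h1 h3 => ?_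
    rw [Sheaf.sat_all_imp]
    refine (forall_lift_iff σ fun v => ∀ z, M.R v X.1 z → z ∈ Y.1).symm.trans
      (forall_congr' fun N'' => forall_congr' fun h' => (forall_acc_iff _ X _).symm.trans ?_)
    simp only [Sheaf.Sat, Function.update_self, Function.update_of_ne, ne_eq, Nat.reduceEqDiff,
      OfNat.zero_ne_ofNat, OfNat.one_ne_ofNat, not_false_eq_true, h0, h1, h3, hX, hY]
    constructor
    · rintro H (τ | Z) hR
      · exact H τ hR
      · cases hR
    · exact fun H τ hR => H (.inl τ) hR
  | th11 =>
    refine sat_forall_sets fun N g X Y hX hY => sat_comprehension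
      ⟨{w | ∃ z, M.R w X.1 z ∧ z ∈ Y.1}, ?_⟩ fun N' h σ g' h0 h1 h3 => ?_
    · rintro w v h ⟨z, hR, hz⟩
      obtain ⟨z', hR', hz'⟩ := M.c1 _ w v z h hR
      exact ⟨z', hR', Y.2 _ _ hz' hz⟩
    · refine (exists_acc_iff σ X _).symm.trans ?_
      simp only [Sheaf.Sat, Function.update_self, Function.update_of_ne, ne_eq,
        Nat.reduceEqDiff, OfNat.zero_ne_ofNat, OfNat.one_ne_ofNat, not_false_eq_true,
        h0, h1, h3, hX, hY]
      constructor
      · rintro ⟨τ, hR, hE⟩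
        exact ⟨.inl τ, hR, hE⟩
      · rintro ⟨τ | Z, hR, hE⟩
        · exact ⟨τ, hR, hE⟩
        · cases hR
  | th12 =>
    intro _ _ _ _ _ _ N' _
    generalize (fun i => M.toSheaf.H _ _) = g
    rintro ⟨h0, h1, H⟩
    obtain ⟨X, hX⟩ := exists_eq_inr h0
    obtain ⟨Y, hY⟩ := exists_eq_inr h1
    refine hX.trans (Eq.trans (congrArg _ (Subtype.ext ?_)) hY.symm)
    rw [Sheaf.sat_allO_iff] at H
    ext v
    -- Every world labels an object at this very node, so agreement on objects gives equality of the
    -- sets.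
    obtain ⟨σ, rfl⟩ := world_surjective N' v
    have := H N' (M.toSheaf.le_refl N') (.inl σ) rfl
    rw [Sheaf.H_refl_comp] at this
    change M.toSheaf.iE N' (.inl σ) (g 0) ↔ M.toSheaf.iE N' (.inl σ) (g 1) at this
    rwa [hX, hY] at this

/-- Leaves the set quantifier of the translation exactly one witness, the truth set; uniqueness
comes from `world_surjective`. -/
theorem sat_code_iff {θ : FO} (φ : Form) {y z : Ind} (hyz : y ≠ z) {N : M.toSheaf.W}
    {f : Ind → M.toSheaf.A N}
    (hθ : ∀ (N : M.toSheaf.W) (f : Ind → M.toSheaf.A N) (σ : Node.Obj N), f z = .inl σ →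
      (M.toSheaf.Sat θ N f ↔ world σ ∈ M.truthSet φ)) (X : M.UpSet) :
    M.toSheaf.Sat (.allO z (.iff (.E z y) θ)) N (Function.update f y (setElem M N X)) ↔
      X = ⟨M.truthSet φ, M.truthSet_mono φ⟩ := by
  rw [Sheaf.sat_allO_iff]
  simp only [Sheaf.Sat, Function.update_self, Function.update_of_ne hyz]
  constructor
  · intro H
    ext v
    obtain ⟨σ, rfl⟩ := world_surjective N v
    exact (H N (M.toSheaf.le_refl N) (.inl σ) rfl).trans (hθ N _ σ (Function.update_self ..))
  · rintro rfl N' h (σ | Y) hO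
    · rw [hθ N' _ σ (Function.update_self ..)]
      rfl
    · cases hO

theorem toSheaf_sat_stdTrans_iff (c : VarChoice) (φ : Form) (x : Ind) {N : M.toSheaf.W}
    {f : Ind → M.toSheaf.A N} {σ : Node.Obj N} (hf : f x = .inl σ) :
    M.toSheaf.Sat (stdTrans c x φ) N f ↔ world σ ∈ M.truthSet φ := by
  induction φ generalizing x N with
  | var p =>
    simp only [stdTrans, Sheaf.Sat, hf]
    rfl
  | top => exact iff_of_true trivial trivial
  | bot => rfl
  | and φ ψ ihφ ihψ => exact and_congr (ihφ x hf) (ihψ x hf)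
  | or φ ψ ihφ ihψ => exact or_congr (ihφ x hf) (ihψ x hf)
  | imp φ ψ ihφ ihψ =>
    refine Iff.trans ?_ (forall_lift_iff σ fun v => v ∈ M.truthSet φ → v ∈ M.truthSet ψ)
    refine forall_congr' fun N' => forall_congr' fun h => ?_
    have hf' : M.toSheaf.H h (f x) = .inl (lift h σ) := by rw [hf]; rfl
    exact imp_congr (ihφ x hf') (ihψ x hf')
  | boxto φ ψ ihφ ihψ =>
    have hd := c.distinct x
    simp only [List.nodup_cons, List.mem_cons, not_or, List.not_mem_nil,
      not_false_eq_true, and_true] at hd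
    obtain ⟨⟨hxy, hxz, hxw⟩, ⟨hyz, hyw⟩, hzw, -⟩ := hd
    have hcode := sat_code_iff (f := f) φ hyz (fun N f σ hf => ihφ (c.z x) (N := N) (f := f) hf)
    have hbox (X : M.UpSet) : M.toSheaf.Sat
        (.all (c.w x) (.imp (.R x (c.y x) (c.w x)) (stdTrans c (c.w x) ψ))) N
          (Function.update f (c.y x) (setElem M N X)) ↔
        ∀ v, M.le (world σ) v → ∀ z, M.R v X.1 z → z ∈ M.truthSet ψ := by
      rw [Sheaf.sat_all_imp]
      refine Iff.trans ?_ (forall_lift_iff σ fun v => ∀ z, M.R v X.1 z → z ∈ M.truthSet ψ)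
      refine forall_congr' fun N' => forall_congr' fun h => Iff.trans ?_ (forall_acc_iff _ X _)
      simp only [Sheaf.Sat, Function.update_self, Function.update_of_ne hxw,
        Function.update_of_ne hyw, Function.update_of_ne hxy, hf]
      constructor
      · exact fun H τ hR => (ihψ _ (Function.update_self ..)).1 (H (.inl τ) hR)
      · rintro H (τ | Z) hR
        · exact (ihψ _ (Function.update_self ..)).2 (H τ hR)
        · cases hR
    constructor
    · rintro ⟨s, hs, h1, h2⟩
      obtain ⟨X, rfl⟩ := exists_eq_inr (by simpa [Sheaf.Sat] using hs)
      obtain rfl := (hcode X).1 h1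
      exact (hbox _).1 h2
    · exact fun H => ⟨setElem M N ⟨_, M.truthSet_mono φ⟩,
        by simp only [Sheaf.Sat, Function.update_self]; rfl, (hcode _).2 rfl, (hbox _).2 H⟩
  | diamondto φ ψ ihφ ihψ =>
    have hd := c.distinct x
    simp only [List.nodup_cons, List.mem_cons, not_or, List.not_mem_nil,
      not_false_eq_true, and_true] at hd
    obtain ⟨⟨hxy, hxz, hxw⟩, ⟨hyz, hyw⟩, hzw, -⟩ := hd
    have hcode := sat_code_iff (f := f) φ hyz (fun N f σ hf => ihφ (c.z x) (N := N) (f := f) hf)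
    have hdia (X : M.UpSet) : M.toSheaf.Sat
        (.ex (c.w x) (.and (.R x (c.y x) (c.w x)) (stdTrans c (c.w x) ψ))) N
          (Function.update f (c.y x) (setElem M N X)) ↔
        ∃ z, M.R (world σ) X.1 z ∧ z ∈ M.truthSet ψ := by
      refine Iff.trans ?_ (exists_acc_iff σ X _)
      simp only [Sheaf.Sat, Function.update_self, Function.update_of_ne hxw,
        Function.update_of_ne hyw, Function.update_of_ne hxy, hf]
      constructor
      · rintro ⟨τ | Z, hR, H⟩
        · exact ⟨τ, hR, (ihψ _ (Function.update_self ..)).1 H⟩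
        · cases hR
      · rintro ⟨τ, hR, H⟩
        exact ⟨.inl τ, hR, (ihψ _ (Function.update_self ..)).2 H⟩
    constructor
    · rintro ⟨s, hs, h1, h2⟩
      obtain ⟨X, rfl⟩ := exists_eq_inr (by simpa [Sheaf.Sat] using hs)
      obtain rfl := (hcode X).1 h1
      exact (hdia _).1 h2
    · exact fun H => ⟨setElem M N ⟨_, M.truthSet_mono φ⟩,
        by simp only [Sheaf.Sat, Function.update_self]; rfl, (hcode _).2 rfl, (hdia _).2 H⟩

end Model

theorem satisfiable_iff_foSatisfiable (c : VarChoice) (Γ Δ : Set Form) (x : Ind) :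
    Satisfiable.{u} Γ Δ ↔ FOSatisfiable.{u} (Th ∪ stdTrans c x '' Γ) (stdTrans c x '' Δ) := by
  constructor
  · rintro ⟨M, w, hΓ, hΔ⟩
    -- The given world becomes the label of the root, whose empty name is the object assigned to the
    -- variables.
    obtain ⟨m, hm, hw⟩ := Model.exists_isFull_root w
    obtain ⟨σ, -, rfl⟩ := Model.Node.exists_obj (N := ⟨m, hm⟩) hw
    have key (φ : Form) := Model.toSheaf_sat_stdTrans_iff (M := M) c φ x (N := ⟨m, hm⟩)
      (f := fun _ => .inl σ) rfl
    refine ⟨M.toSheaf, ⟨m, hm⟩, fun _ => .inl σ, ?_, ?_⟩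
    · rintro _ (hφ | ⟨φ, hφ, rfl⟩)
      · exact Model.toSheaf_sat_th hφ _ _
      · exact (key φ).2 (hΓ φ hφ)
    · rintro _ ⟨ψ, hψ, rfl⟩ H
      exact hΔ ψ hψ ((key ψ).1 H)
  · rintro ⟨S, w, f, hΓ, hΔ⟩
    have key (φ : Form) := Sheaf.sat_stdTrans_iff (fun φ hφ => hΓ φ (.inl hφ)) c φ x
      (S.le_refl w) f
    exact ⟨S.toModel w, ⟨w, f x⟩, fun φ hφ => (key φ).1 (hΓ _ (.inr ⟨φ, hφ, rfl⟩)),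
      fun ψ hψ H => hΔ _ ⟨ψ, hψ, rfl⟩ ((key ψ).2 H)⟩

end CondLogic

theorem theorem2 (c : CondLogic.VarChoice) (Γ Δ : Set CondLogic.Form) (x : CondLogic.Ind) :
    CondLogic.Follows.{u} Γ Δ ↔
      CondLogic.FOFollows.{u} (CondLogic.Th ∪ CondLogic.stdTrans c x '' Γ) (CondLogic.stdTrans c x '' Δ) := by
  exact not_congr (CondLogic.satisfiable_iff_foSatisfiable c Γ Δ x)
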